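/- Fix a universal prefix-free machine $U$ (a Turing machine with prefix-free domain such that for every partial computable $M$ on binary strings with prefix-free domain there is a string $\rho$ with $U(\rho\sigma)\simeq M(\sigma)$ for all $\sigma$) and a universal lower semicomputable continuous semimeasure $\mathbf M$ on $2^{<\omega}$. For $\tau\in 2^{<\omega}$ let $K(\tau)=\min\{|p| : U(p){\downarrow}=\tau\}$, and for a computable non-decreasing $t:\omega\to\omega$ let $K^t(\tau)=\min\{|p| : U(p){\downarrow}=\tau \text{ in at most } t(|\tau|)\text{ steps}\}$ (with $\min\emptyset=\infty$). A sequence $X\in2^\omega$ is strongly deep if $K^t(X{\upharpoonright}n)-K(X{\upharpoonright}n)\to\infty$ as $n\to\infty$, for every computable non-decreasing $t$. For a $\Pi^0_1$ class $\mathcal P\subseteq2^\omega$ let $T_n$ be the set of length-$n$ initial segments of members of $\mathcal P$; $\mathcal P$ is deep if there is a computable, non-decreasing, unbounded function $g:\omega\to\omega$ with $\sum_{\sigma\in T_n}\mathbf M(\sigma)\le 2^{-g(n)}$ for all $n$. Theorem. There is a $\Pi^0_1$ class $\mathcal P\subseteq 2^\omega$ such that (i) every $X\in\mathcal P$ is strongly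 deep, but (ii) $\mathcal P$ is not deep. -/

import Mathlib

namespace DeepClass

/-- `X ↾ n`, the string of the first `n` bits of the sequence `X`. -/
def initSeg (X : ℕ → Bool) (n : ℕ) : List Bool := (List.range n).map X

/-! ### Turing machines and their step counts -/

/-- A one-tape Turing machine with finitely many states and tape alphabet `{0, 1, blank}`
(`none` is the blank symbol, `0` is the initial state). In one step it either moves its head by one
cell or writes one symbol; it halts when no instruction applies. -/
structure TuringMachine where
  states : ℕ
  prog : Turing.TM0.Machine (Option Bool) (Fin (states + 1))

/-- The configuration of `U` on input `p` after `s` steps (`none` if `U` has halted before). At the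
start the tape contains exactly `p` and the head is on the first symbol of `p`. -/
def TuringMachine.configAt (U : TuringMachine) (p : List Bool) (s : ℕ) :
    Option (Turing.TM0.Cfg (Option Bool) (Fin (U.states + 1))) :=
  (fun c => c.bind (Turing.TM0.step U.prog))^[s] (some (Turing.TM0.init (p.map some)))

/-- `U` on input `p` halts after exactly `s` steps with output `τ`: the tape, from the position of
the head rightwards, contains exactly `τ` followed by blanks. -/
def TuringMachine.HaltsAfter (U : TuringMachine) (p τ : List Bool) (s : ℕ) : Prop :=
  ∃ c, U.configAt p s = some c ∧ Turing.TM0.step U.prog c = none ∧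
    c.Tape.right₀ = Turing.ListBlank.mk (τ.map some)

/-- `U(p)↓ = τ`. -/
def TuringMachine.Outputs (U : TuringMachine) (p τ : List Bool) : Prop :=
  ∃ s, U.HaltsAfter p τ s

/-- `U(p)↓ = τ` in at most `t` steps. -/
def TuringMachine.OutputsWithin (U : TuringMachine) (p τ : List Bool) (t : ℕ) : Prop :=
  ∃ s ≤ t, U.HaltsAfter p τ s

/-- No string in `D` is a proper prefix of another string in `D`. -/
def PrefixFree (D : Set (List Bool)) : Prop :=
  ∀ σ ∈ D, ∀ ρ ∈ D, σ <+: ρ → σ = ρ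

/-- `U` is a universal prefix-free machine: its domain is prefix-free, and for every partial
computable `M` with prefix-free domain there is a string `ρ` such that `U(ρσ) ≃ M(σ)` for
all `σ`. -/
def TuringMachine.IsUniversalPrefixFree (U : TuringMachine) : Prop :=
  PrefixFree {p | ∃ τ, U.Outputs p τ} ∧
  ∀ M : List Bool →. List Bool, Partrec M → PrefixFree M.Dom →
    ∃ ρ : List Bool, ∀ σ τ, U.Outputs (ρ ++ σ) τ ↔ τ ∈ M σ

/-! ### Prefix-free complexity and strong depth -/

/-- Prefix-free Kolmogorov complexity `K(τ) = min {|p| : U(p)↓ = τ}` (`⊤` if there is no such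
`p`). -/
noncomputable def complexity (U : TuringMachine) (τ : List Bool) : ℕ∞ :=
  ⨅ (p : List Bool) (_ : U.Outputs p τ), (p.length : ℕ∞)

/-- Time-bounded complexity `K^t(τ) = min {|p| : U(p)↓ = τ in ≤ t(|τ|) steps}` (`⊤` if there is no
such `p`). -/
noncomputable def timeComplexity (U : TuringMachine) (t : ℕ → ℕ) (τ : List Bool) : ℕ∞ :=
  ⨅ (p : List Bool) (_ : U.OutputsWithin p τ (t τ.length)), (p.length : ℕ∞)

/-- `X` is strongly deep: for every computable time bound `t` (total and non-decreasing),
`K^t(X ↾ n) - K(X ↾ n) → ∞`. -/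
def IsStronglyDeep (U : TuringMachine) (X : ℕ → Bool) : Prop :=
  ∀ t : ℕ → ℕ, Computable t → Monotone t →
    ∀ c : ℕ, ∀ᶠ n in Filter.atTop,
      complexity U (initSeg X n) + (c : ℕ∞) ≤ timeComplexity U t (initSeg X n)

/-! ### Continuous semimeasures -/

/-- A continuous semimeasure on strings. -/
structure IsContSemimeasure (P : List Bool → ℝ) : Prop where
  nonneg : ∀ σ, 0 ≤ P σ
  root : P [] ≤ 1
  split : ∀ σ, P (σ ++ [false]) + P (σ ++ [true]) ≤ P σ

/-- A nonnegative real function on strings is lower semicomputable: each value `f σ` is the limit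
of a nondecreasing sequence of rationals, computable uniformly in `σ`. -/
def IsLowerSemicomputable (f : List Bool → ℝ) : Prop :=
  ∃ a b : List Bool → ℕ → ℕ, Computable₂ a ∧ Computable₂ b ∧
    ∀ σ, Monotone (fun s => (a σ s : ℝ) / ((b σ s : ℝ) + 1)) ∧
      Filter.Tendsto (fun s => (a σ s : ℝ) / ((b σ s : ℝ) + 1)) Filter.atTop (nhds (f σ))

/-- `M` is a universal lower semicomputable continuous semimeasure. -/
structure IsUniversalContSemimeasure (M : List Bool → ℝ) : Prop where
  semimeasure : IsContSemimeasure M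
  lowerSemicomputable : IsLowerSemicomputable M
  universal : ∀ P : List Bool → ℝ, IsContSemimeasure P → IsLowerSemicomputable P →
    ∃ c : ℝ, ∀ σ, P σ ≤ c * M σ

/-! ### Effectively closed classes and depth -/

/-- `P` is a `Π⁰₁` class: its complement is the union of the cylinders `⟦σ⟧` over a c.e. set of
strings `σ`. -/
def IsPi01Class (P : Set (ℕ → Bool)) : Prop :=
  ∃ W : List Bool → Prop, REPred W ∧ P = {X | ∀ n, ¬ W (initSeg X n)}

/-- The canonical tree of `P` at level `n`: the set `T_n` of all initial segments of length `n` of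
members of `P`. -/
def treeLevel (P : Set (ℕ → Bool)) (n : ℕ) : Set (List Bool) :=
  {σ | ∃ X ∈ P, σ = initSeg X n}

/-- `g` is a computable order: computable, non-decreasing and unbounded. -/
def IsComputableOrder (g : ℕ → ℕ) : Prop :=
  Computable g ∧ Monotone g ∧ ∀ k, ∃ n, k ≤ g n

/-- The class `P` is deep: `M(T_n) = ∑_{σ ∈ T_n} M(σ) ≤ 2^{-g(n)}` for all `n`, for some computable
order `g`. -/
def IsDeep (M : List Bool → ℝ) (P : Set (ℕ → Bool)) : Prop :=
  ∃ g : ℕ → ℕ, IsComputableOrder g ∧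
    ∀ n, ∑ᶠ σ ∈ treeLevel P n, M σ ≤ (2 : ℝ)⁻¹ ^ g n

end DeepClass

/-!
Write `ψ x` for the value at `x = ⟨i, y⟩` of the `i`-th partial computable function. The class
consists of sequences `X` that agree with `ψ`, in the sense that `X x = 1 ↔ ψ x = 1` whenever `ψ
x` is defined, up to finitely many exceptions. The exceptions are arranged so that the class
contains an extension of each member of a computable sequence of strings.

*Agreement.* Let `stageString r` be the string of length `r` that agrees with the values of `ψ`
known at stage `r`. The class `agreementClass` contains the sequences that agree with `ψ`
everywhere, and for each `r` the sequences that extend `stageString r` and agree with `ψ` beyond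
`r`. It is a `Π⁰₁` class, because a disagreement that is seen at stage `s` cannot occur in
`stageString r` for `r ≥ s`, so that only finitely many `r` have to be inspected to refute it. A
member disagrees with only finitely many values of `ψ` (`eventually_agrees_of_mem`).

*The class is not deep* (`not_isDeep_of_computable`). Its tree contains `stageString r` for every
`r`. If `g` is a computable order and `r_d` is the first `r` with `g r ≥ 2d`, then the strings
`stageString (r_d)` form a computable sequence, and a semimeasure with point masses `2^{-d-1}` at
them shows that their universal weight is at least `2^{-d}` up to a constant factor. A bound
`2^{-g}` would make it at most `2^{-2d}`.

*The members are strongly deep* (`isStronglyDeep_of_eventually_agrees`). Let `t` be a computable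
time bound. There is a computable set that spells, on each of the blocks `{⟨i, 2^m + r⟩ : r <
2^m}`, a string `w` chosen by counting (`exists_isSparse`): for each `k < 2^{4m}`, at most a
fraction `2^{-6m}` of the programs of length `k` produce, within the relevant time, an output that
contains `w` on the block. This set is computed by some function with index `i`, and thus `X`
coincides with it on almost all of the column `i`. Given `n`, let `m` be maximal such that `⟨i,
2^{m+1}⟩ ≤ n`; then block `m` of this column lies below `n`, and `log n` is about `2m`. A program
`p` of length `k < 2^{4m}` that outputs `X ↾ n` within time `t n` is determined by `m` (in `m + 1`
bits), `k` (in `4m` bits) and its index among the few matching programs (in `k - 6m` bits), so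
that the complexity of `X ↾ n` is at most `k - m + O(1)`. If `k ≥ 2^{4m}`, then `k` exceeds the
trivial bound `2n + O(1)` on the complexity of `X ↾ n` by far.
-/

namespace DeepClass

open Nat.Partrec (Code)

/-! ### Lists of strings -/

/-- The list of all binary strings of length `k`. -/
def strings : ℕ → List (List Bool)
  | 0 => [[]]
  | k + 1 => (strings k).map (false :: ·) ++ (strings k).map (true :: ·)

theorem mem_strings {k : ℕ} {σ : List Bool} : σ ∈ strings k ↔ σ.length = k := by
  induction k generalizing σ with
  | zero => simp [strings]
  | succ k ih =>
    cases σ with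
    | nil => simp [strings]
    | cons b σ => cases b <;> simp [strings, ih]

theorem length_strings (k : ℕ) : (strings k).length = 2 ^ k := by
  induction k with
  | zero => rfl
  | succ k ih => simp [strings, ih]; ring

theorem nodup_strings (k : ℕ) : (strings k).Nodup := by
  induction k with
  | zero => simp [strings]
  | succ k ih =>
    refine List.Nodup.append (ih.map (List.cons_injective)) (ih.map (List.cons_injective)) ?_
    intro σ h1 h2
    simp only [List.mem_map] at h1 h2
    obtain ⟨a, -, rfl⟩ := h1
    obtain ⟨b, -, hb⟩ := h2
    simp at hb

theorem primrec_strings : Primrec strings := by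
  have h : Primrec₂ fun (_ : ℕ) (l : List (List Bool)) =>
      l.map (false :: ·) ++ l.map (true :: ·) :=
    Primrec.list_append.comp₂
      (Primrec.list_map Primrec.snd (Primrec.list_cons.comp₂ (Primrec₂.const false) Primrec₂.right))
      (Primrec.list_map Primrec.snd (Primrec.list_cons.comp₂ (Primrec₂.const true) Primrec₂.right))
  refine (Primrec.nat_rec₁ [[]] h).of_eq fun n => ?_
  induction n with
  | zero => rfl
  | succ n ih => simp only [strings, ih]

/-! ### Simulation of Turing machines on lists -/

/-- One instruction as an edit of the two halves of the tape: the data `(q', (A, a), (B, b))` means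
that the new state is `q'`, that the first `a` cells of the left half are replaced by `A`, and that
the first `b` cells of the right half are replaced by `B`. The arguments are the state and the first
cells of the right and of the left half; a halted machine changes nothing. -/
def TuringMachine.edit (U : TuringMachine) :
    Fin (U.states + 1) × Option Bool × Option Bool →
      Fin (U.states + 1) × (List (Option Bool) × ℕ) × (List (Option Bool) × ℕ)
  | (q, a, l) => match U.prog q a with
    | none => (q, ([], 0), ([], 0))
    | some (q', .move .left) => (q', ([], 1), ([l], 0))
    | some (q', .move .right) => (q', ([a], 0), ([], 1))
    | some (q', .write b) => (q', ([], 0), ([b], 1))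

/-- A configuration whose tape is given by finite lists: the state, the cells to the left of the
head (nearest first), and the cells from the head rightwards. -/
abbrev TuringMachine.ListCfg (U : TuringMachine) : Type :=
  Fin (U.states + 1) × List (Option Bool) × List (Option Bool)

/-- The step function on list configurations; it fixes halted configurations. -/
def TuringMachine.listStep (U : TuringMachine) (c : U.ListCfg) : U.ListCfg :=
  let e := U.edit (c.1, c.2.2.headI, c.2.1.headI)
  (e.1, e.2.1.1 ++ c.2.1.drop e.2.1.2, e.2.2.1 ++ c.2.2.drop e.2.2.2)

/-- The configuration of the machine that a list configuration stands for. -/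
def TuringMachine.ListCfg.toCfg {U : TuringMachine} (c : U.ListCfg) :
    Turing.TM0.Cfg (Option Bool) (Fin (U.states + 1)) :=
  ⟨c.1, Turing.Tape.mk' (Turing.ListBlank.mk c.2.1) (Turing.ListBlank.mk c.2.2)⟩

/-- The bits found from the head rightwards after `T` steps of `U` on input `p` (or when `U` halts,
if it halts earlier). If `U` has halted by then with some output, this is the output. -/
def TuringMachine.run (U : TuringMachine) (p : List Bool) (T : ℕ) : List Bool :=
  (U.listStep^[T] (0, [], p.map some)).2.2.filterMap id

theorem TuringMachine.step_toCfg (U : TuringMachine) (c : U.ListCfg) :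
    (Turing.TM0.step U.prog c.toCfg).getD c.toCfg = (U.listStep c).toCfg := by
  obtain ⟨q, L, R⟩ := c
  simp only [TuringMachine.ListCfg.toCfg, TuringMachine.listStep, TuringMachine.edit,
    Turing.TM0.step, Turing.Tape.mk'_head, Turing.ListBlank.head_mk]
  rcases U.prog q R.headI with _ | ⟨q', (d | b)⟩
  · simp
  · cases d
    · simp [Turing.Tape.move_left_mk']
    · simp [Turing.Tape.move_right_mk']
  · simp [Turing.Tape.write_mk']

theorem filterMap_of_mk_eq {l : List (Option Bool)} {τ : List Bool}
    (h : Turing.ListBlank.mk l = Turing.ListBlank.mk (τ.map some)) : l.filterMap id = τ := by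
  have blank : ∀ n, List.filterMap id (List.replicate n (default : Option Bool)) = [] := by
    intro n
    induction n with
    | zero => rfl
    | succ n ih => rw [List.replicate_succ, List.filterMap_cons]; exact ih
  have h' : Turing.BlankRel l (τ.map some) := Quotient.exact h
  rcases h' with ⟨n, hn⟩ | ⟨n, hn⟩
  · have := congrArg (List.filterMap id) hn
    rw [List.filterMap_append, blank] at this
    simpa using this.symm
  · have := congrArg (List.filterMap id) hn
    rw [List.filterMap_append, blank] at this
    simpa using this

theorem TuringMachine.run_eq_of_outputsWithin (U : TuringMachine) {p τ : List Bool} {T : ℕ}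
    (h : U.OutputsWithin p τ T) : U.run p T = τ := by
  obtain ⟨s, hs, c, hc, hhalt, hout⟩ := h
  have simulates : ∀ n d, U.configAt p n = some d →
      (U.listStep^[n] (0, [], p.map some)).toCfg = d := by
    intro n
    induction n with
    | zero =>
      intro d hd
      simp only [TuringMachine.configAt, Function.iterate_zero, id, Option.some.injEq] at hd
      subst hd
      rfl
    | succ n ih =>
      intro d hd
      rw [TuringMachine.configAt, Function.iterate_succ_apply'] at hd
      obtain ⟨e, he, hed⟩ := Option.bind_eq_some_iff.1 hd
      rw [Function.iterate_succ_apply', ← U.step_toCfg, ih e he, hed]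
      rfl
  -- after halting, the list configuration still stands for the same configuration
  have stay : ∀ n, (U.listStep^[s + n] (0, [], p.map some)).toCfg = c := by
    intro n
    induction n with
    | zero => exact simulates s c hc
    | succ n ih =>
      rw [← add_assoc, Function.iterate_succ_apply', ← U.step_toCfg, ih, hhalt]
      rfl
  have hT := stay (T - s)
  rw [Nat.add_sub_cancel' hs] at hT
  refine filterMap_of_mk_eq ?_
  rw [← hout, ← hT]
  simp [TuringMachine.ListCfg.toCfg]

theorem TuringMachine.primrec_run (U : TuringMachine) : Primrec₂ U.run := by
  have he : Primrec fun c : U.ListCfg => U.edit (c.1, c.2.2.headI, c.2.1.headI) :=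
    (Primrec.dom_finite U.edit).comp (Primrec.fst.pair
      ((Primrec.list_headI.comp (Primrec.snd.comp Primrec.snd)).pair
        (Primrec.list_headI.comp (Primrec.fst.comp Primrec.snd))))
  have he1 := Primrec.fst.comp (Primrec.snd.comp he)
  have he2 := Primrec.snd.comp (Primrec.snd.comp he)
  have hstep : Primrec U.listStep :=
    (Primrec.fst.comp he).pair
      ((Primrec.list_append.comp (Primrec.fst.comp he1)
        (Primrec.list_drop.comp (Primrec.snd.comp he1) (Primrec.fst.comp Primrec.snd))).pair
      (Primrec.list_append.comp (Primrec.fst.comp he2)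
        (Primrec.list_drop.comp (Primrec.snd.comp he2) (Primrec.snd.comp Primrec.snd))))
  have hinit : Primrec fun a : List Bool × ℕ =>
      (((0 : Fin (U.states + 1)), ([] : List (Option Bool)), a.1.map some) : U.ListCfg) :=
    (Primrec.const 0).pair ((Primrec.const []).pair
      (Primrec.list_map Primrec.fst (Primrec.option_some.comp₂ Primrec₂.right)))
  have hit : Primrec fun a : List Bool × ℕ => U.listStep^[a.2] (0, [], a.1.map some) :=
    Primrec.nat_iterate Primrec.snd hinit (hstep.comp₂ Primrec₂.right)
  exact Primrec.listFilterMap (Primrec.snd.comp (Primrec.snd.comp hit)) Primrec₂.right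

/-! ### Upper bounds on prefix-free complexity -/

/-- A family of decompressors `u ↦ f m u`, the `m`-th one with prefix-free domain `{u | D m u}`,
gives short programs: the string `1^m 0 u` is an input of a prefix-free machine that computes
`f m u`. -/
theorem exists_complexity_le {U : TuringMachine} (hU : U.IsUniversalPrefixFree)
    {f : ℕ → List Bool → List Bool} {D : ℕ → List Bool → Bool} (hf : Computable₂ f)
    (hD : Computable₂ D) (hfree : ∀ m, PrefixFree {u | D m u = true}) :
    ∃ C : ℕ, ∀ m u, D m u = true → complexity U (f m u) ≤ ((m + u.length + C : ℕ) : ℕ∞) := by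
  let V : List Bool → Option (List Bool) := fun l =>
    bif decide (l.idxOf false < l.length) && D (l.idxOf false) (l.drop (l.idxOf false + 1))
    then some (f (l.idxOf false) (l.drop (l.idxOf false + 1))) else none
  have hidx : Primrec fun l : List Bool => l.idxOf false :=
    Primrec.list_idxOf.comp (Primrec.const false) Primrec.id
  have hdrop : Computable fun l : List Bool => l.drop (l.idxOf false + 1) :=
    (Primrec.list_drop.comp (Primrec.succ.comp hidx) Primrec.id).to_comp
  have hV : Computable V :=
    Computable.cond
      (Primrec.and.to_comp.comp
        (Primrec.nat_lt.decide.comp hidx Primrec.list_length).to_comp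
        (hD.comp hidx.to_comp hdrop))
      (Computable.option_some.comp (hf.comp hidx.to_comp hdrop))
      (Computable.const none)
  let W : List Bool →. List Bool := fun l => V l
  have hdom : ∀ l : List Bool, l ∈ W.Dom ↔
      l.idxOf false < l.length ∧ D (l.idxOf false) (l.drop (l.idxOf false + 1)) = true := by
    intro l
    change (V l : Part (List Bool)).Dom ↔ _
    rw [Part.ofOption_dom, ← decide_eq_true_iff (p := _ < _), ← Bool.and_eq_true_iff]
    simp only [V]
    cases decide (l.idxOf false < l.length) && D (l.idxOf false) (l.drop (l.idxOf false + 1)) <;>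
      simp
  have hWfree : PrefixFree W.Dom := by
    rintro l hl _ hl' ⟨s, rfl⟩
    rw [hdom] at hl hl'
    have hmem : false ∈ l := List.idxOf_lt_length_iff.1 hl.1
    rw [List.idxOf_append_of_mem hmem, List.drop_append_of_le_length hl.1] at hl'
    have := hfree _ _ hl.2 _ hl'.2 (List.prefix_append _ _)
    simpa using this
  obtain ⟨ρ, hρ⟩ := hU.2 W hV.ofOption hWfree
  refine ⟨ρ.length + 1, fun m u hu => ?_⟩
  have hi : (List.replicate m true ++ false :: u).idxOf false = m := by
    rw [List.idxOf_append_of_notMem (by simp)]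
    simp
  have hd : (List.replicate m true ++ false :: u).drop (m + 1) = u := by
    rw [List.drop_append]
    simp
  have hout : U.Outputs (ρ ++ (List.replicate m true ++ false :: u)) (f m u) := by
    rw [hρ]
    simp [W, V, hi, hd, hu]
  refine (iInf₂_le (f := fun p (_ : U.Outputs p (f m u)) => (p.length : ℕ∞)) _ hout).trans ?_
  simp only [List.length_append, List.length_replicate, List.length_cons]
  exact_mod_cast (by omega)

theorem exists_complexity_le_two_mul_length {U : TuringMachine} (hU : U.IsUniversalPrefixFree) :
    ∃ C : ℕ, ∀ σ : List Bool, complexity U σ ≤ ((2 * σ.length + C : ℕ) : ℕ∞) := by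
  obtain ⟨C, hC⟩ := exists_complexity_le hU (f := fun _ u => u)
    (D := fun m u => decide (u.length = m)) Computable.snd.to₂
    (Primrec.eq.decide.comp (Primrec.list_length.comp Primrec.snd) Primrec.fst).to_comp.to₂
    (by
      intro m σ hσ ρ hρ h
      simp only [Set.mem_ofPred_eq, decide_eq_true_eq] at hσ hρ
      exact h.eq_of_length (hσ.trans hρ.symm))
  refine ⟨C, fun σ => (hC σ.length σ (by simp)).trans ?_⟩
  exact_mod_cast (by omega)

/-! ### Sparse strings -/

/-- The bits of `τ` on block `m` of column `i`, that is, at the positions `⟨i, 2^m + r⟩` with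
`r < 2^m`. -/
def blockOf (i m : ℕ) (τ : List Bool) : List Bool :=
  (List.range (2 ^ m)).map fun r => τ.getD (Nat.pair i (2 ^ m + r)) false

/-- The programs of length `k` whose output within time `T` has `w` on block `m` of column `i`. -/
def matching (U : TuringMachine) (a : ℕ × ℕ × ℕ) (k : ℕ) (w : List Bool) : List (List Bool) :=
  (strings k).filter fun p => blockOf a.1 a.2.1 (U.run p a.2.2) = w

/-- For all `k < 2^{4m}`, at most a fraction `2^{-6m}` of the programs of length `k` match `w` on
block `m` of column `i` within time `T`, where `a = (i, m, T)`. -/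
def IsSparse (U : TuringMachine) (a : ℕ × ℕ × ℕ) (w : List Bool) : Prop :=
  ∀ k < 2 ^ (4 * a.2.1), (matching U a k w).length * 2 ^ (6 * a.2.1) ≤ 2 ^ k

instance (U : TuringMachine) (a : ℕ × ℕ × ℕ) : DecidablePred (IsSparse U a) := fun w =>
  inferInstanceAs
    (Decidable (∀ k < 2 ^ (4 * a.2.1), (matching U a k w).length * 2 ^ (6 * a.2.1) ≤ 2 ^ k))

/-- The first sparse string of length `2^m` (or `[]` if there is none). -/
def sparseString (U : TuringMachine) (a : ℕ × ℕ × ℕ) : List Bool :=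
  ((strings (2 ^ a.2.1)).filter fun w => IsSparse U a w).headI

theorem primrec_two_pow : Primrec fun n : ℕ => 2 ^ n := by
  have h : Primrec₂ fun (_ : ℕ) (y : ℕ) => 2 * y := Primrec.nat_double.comp₂ Primrec₂.right
  refine (Primrec.nat_rec₁ 1 h).of_eq fun n => ?_
  induction n with
  | zero => rfl
  | succ n ih => rw [pow_succ, mul_comm, ← ih]

theorem primrec_two_pow_mul {α : Type*} [Primcodable α] {f : α → ℕ} (c : ℕ) (hf : Primrec f) :
    Primrec fun a => 2 ^ (c * f a) :=
  primrec_two_pow.comp (Primrec.nat_mul.comp (Primrec.const c) hf)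

theorem primrecPred_forall_lt {α : Type*} [Primcodable α] {R : ℕ → α → Prop} {f : α → ℕ}
    (hR : PrimrecRel R) (hf : Primrec f) : PrimrecPred fun a => ∀ k < f a, R k a :=
  (hR.forall_mem_list.comp (Primrec.list_range.comp hf) Primrec.id).of_eq (by simp)

theorem primrec_blockOf :
    Primrec fun x : (ℕ × ℕ) × List Bool => blockOf x.1.1 x.1.2 x.2 := by
  refine Primrec.list_map (Primrec.list_range.comp
    (primrec_two_pow.comp (Primrec.snd.comp Primrec.fst))) ?_
  refine (Primrec.list_getD false).comp₂ (Primrec.snd.comp Primrec.fst) ?_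
  exact Primrec₂.natPair.comp₂ (Primrec.fst.comp (Primrec.fst.comp Primrec.fst))
    (Primrec.nat_add.comp₂ (primrec_two_pow.comp (Primrec.snd.comp (Primrec.fst.comp Primrec.fst)))
      Primrec.snd)

theorem primrec_matching (U : TuringMachine) :
    Primrec fun x : ((ℕ × ℕ × ℕ) × ℕ) × List Bool => matching U x.1.1 x.1.2 x.2 := by
  have hR : PrimrecRel fun (p : List Bool) (y : (ℕ × ℕ × ℕ) × List Bool) =>
      blockOf y.1.1 y.1.2.1 (U.run p y.1.2.2) = y.2 := by
    have ha : Primrec fun z : List Bool × ((ℕ × ℕ × ℕ) × List Bool) => z.2.1 :=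
      Primrec.fst.comp Primrec.snd
    refine Primrec.eq.comp₂ ?_ (Primrec.snd.comp Primrec.snd)
    refine primrec_blockOf.comp (Primrec.pair (Primrec.pair (Primrec.fst.comp ha)
      (Primrec.fst.comp (Primrec.snd.comp ha))) ?_)
    exact U.primrec_run.comp Primrec.fst (Primrec.snd.comp (Primrec.snd.comp ha))
  exact (hR.listFilter.comp (primrec_strings.comp (Primrec.snd.comp Primrec.fst))
    ((Primrec.fst.comp Primrec.fst).pair Primrec.snd)).of_eq fun x => rfl

theorem primrecRel_isSparse (U : TuringMachine) :
    PrimrecRel fun (w : List Bool) (a : ℕ × ℕ × ℕ) => IsSparse U a w := by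
  have hR : PrimrecRel fun (k : ℕ) (y : List Bool × ℕ × ℕ × ℕ) =>
      (matching U y.2 k y.1).length * 2 ^ (6 * y.2.2.1) ≤ 2 ^ k := by
    have hm : Primrec fun z : ℕ × (List Bool × ℕ × ℕ × ℕ) => z.2.2.2.1 :=
      Primrec.fst.comp (Primrec.snd.comp (Primrec.snd.comp Primrec.snd))
    refine Primrec.nat_le.comp₂ ?_ (primrec_two_pow.comp Primrec.fst)
    refine Primrec.nat_mul.comp (Primrec.list_length.comp ?_) (primrec_two_pow_mul 6 hm)
    exact (primrec_matching U).comp (Primrec.pair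
      (Primrec.pair (Primrec.snd.comp Primrec.snd) Primrec.fst) (Primrec.fst.comp Primrec.snd))
  exact primrecPred_forall_lt hR
    (primrec_two_pow_mul 4 (Primrec.fst.comp (Primrec.snd.comp Primrec.snd)))

theorem primrec_sparseString (U : TuringMachine) : Primrec (sparseString U) :=
  Primrec.list_headI.comp ((primrecRel_isSparse U).listFilter.comp
    (primrec_strings.comp (primrec_two_pow.comp (Primrec.fst.comp Primrec.snd))) Primrec.id)

theorem sum_length_matching (U : TuringMachine) (a : ℕ × ℕ × ℕ) (k : ℕ) :
    ∑ w ∈ (strings (2 ^ a.2.1)).toFinset, (matching U a k w).length = 2 ^ k := by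
  have h : ∀ w, (matching U a k w).length =
      ((strings k).toFinset.filter fun p => blockOf a.1 a.2.1 (U.run p a.2.2) = w).card := by
    intro w
    rw [matching, ← List.toFinset_card_of_nodup ((nodup_strings k).filter _),
      List.toFinset_filter]
    simp
  simp only [h]
  rw [← Finset.card_eq_sum_card_fiberwise, List.toFinset_card_of_nodup (nodup_strings k),
    length_strings]
  intro p _
  simp [mem_strings, blockOf]

/-- Counting: if no string of length `2^m` were sparse, the programs of lengths below `2^{4m}`
would be too few to be responsible for this, as each of them matches only one string. For each of
the `2^{4m}` lengths there are fewer than `2^{6m}` strings that match too many programs, whence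
the condition `10m ≤ 2^m`. -/
theorem exists_isSparse (U : TuringMachine) (a : ℕ × ℕ × ℕ) (ha : 10 * a.2.1 ≤ 2 ^ a.2.1) :
    ∃ w ∈ strings (2 ^ a.2.1), IsSparse U a w := by
  by_contra! hno
  set m := a.2.1 with hm
  let F : List Bool → ℕ → ℚ := fun w k =>
    (matching U a k w).length * 2 ^ (6 * m) / 2 ^ k
  have hF : ∀ w k, 0 ≤ F w k := fun w k => by positivity
  have h1 : ∀ w ∈ (strings (2 ^ m)).toFinset, 1 < ∑ k ∈ Finset.range (2 ^ (4 * m)), F w k := by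
    intro w hw
    have := hno w (List.mem_toFinset.1 hw)
    simp only [IsSparse, not_forall, not_le] at this
    obtain ⟨k, hk, hlt⟩ := this
    refine lt_of_lt_of_le ?_ (Finset.single_le_sum (fun k _ => hF w k) (Finset.mem_range.2 hk))
    rw [lt_div_iff₀ (by positivity), one_mul]
    exact_mod_cast hlt
  have h2 := Finset.sum_lt_sum_of_nonempty (s := (strings (2 ^ m)).toFinset)
    ⟨List.replicate (2 ^ m) true, by simp [mem_strings]⟩ h1
  rw [Finset.sum_comm] at h2
  have h3 : ∀ k, ∑ w ∈ (strings (2 ^ m)).toFinset, F w k = 2 ^ (6 * m) := by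
    intro k
    have := sum_length_matching U a k
    rw [← hm] at this
    simp only [F, ← Finset.sum_div, ← Finset.sum_mul]
    rw [← Nat.cast_sum, this]
    push_cast
    field_simp
  simp only [h3, Finset.sum_const, List.toFinset_card_of_nodup (nodup_strings _), length_strings,
    Finset.card_range, nsmul_eq_mul, mul_one] at h2
  have h4 : 2 ^ 2 ^ m < 2 ^ (4 * m) * 2 ^ (6 * m) := by exact_mod_cast h2
  rw [← pow_add, Nat.pow_lt_pow_iff_right (by norm_num)] at h4
  omega

theorem sparseString_spec (U : TuringMachine) (a : ℕ × ℕ × ℕ) (ha : 10 * a.2.1 ≤ 2 ^ a.2.1) :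
    (sparseString U a).length = 2 ^ a.2.1 ∧ IsSparse U a (sparseString U a) := by
  obtain ⟨w, hw, hs⟩ := exists_isSparse U a ha
  have hne : (strings (2 ^ a.2.1)).filter (fun w => IsSparse U a w) ≠ [] :=
    List.ne_nil_of_mem (List.mem_filter.2 ⟨hw, by simpa using hs⟩)
  obtain ⟨v, l, hvl⟩ := List.exists_cons_of_ne_nil hne
  have hv : v ∈ (strings (2 ^ a.2.1)).filter fun w => IsSparse U a w := by simp [hvl]
  rw [sparseString, hvl]
  simpa [mem_strings] using hv

/-! ### A computable set that resists a time bound -/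

theorem primrec_log_two : Primrec (Nat.log 2) := by
  have h : PrimrecRel fun (n m : ℕ) => 2 ^ m ≤ n :=
    Primrec.nat_le.comp₂ (primrec_two_pow.comp₂ Primrec₂.right) Primrec₂.left
  refine (Primrec.nat_findGreatest Primrec.id h).of_eq fun n => ?_
  rcases Nat.eq_zero_or_pos n with rfl | hn
  · simp
  refine (Nat.findGreatest_eq_iff).2 ⟨Nat.log_le_self 2 n, fun _ => Nat.pow_log_le_self 2 hn.ne',
    fun m hm _ => ?_⟩
  exact not_le.2 (Nat.lt_pow_of_log_lt (by norm_num) hm)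

/-- The bit of a computable set that resists the time bound `t`: each block `m` of each column `i`
spells the string `sparseString U (i, m, T)`, where `T = t(⟨i, 2^{m+2}⟩)`. -/
def resistantBit (U : TuringMachine) (t : ℕ → ℕ) (x : ℕ) : Bool :=
  let i := x.unpair.1
  let m := Nat.log 2 x.unpair.2
  (sparseString U (i, m, t (Nat.pair i (2 ^ (m + 2))))).getD (x.unpair.2 - 2 ^ m) false

theorem resistantBit_pair (U : TuringMachine) (t : ℕ → ℕ) {i m r : ℕ} (hr : r < 2 ^ m) :
    resistantBit U t (Nat.pair i (2 ^ m + r)) =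
      (sparseString U (i, m, t (Nat.pair i (2 ^ (m + 2))))).getD r false := by
  have hlog : Nat.log 2 (2 ^ m + r) = m := by
    rw [Nat.log_eq_iff (Or.inr ⟨by norm_num, by positivity⟩)]
    exact ⟨by omega, by rw [pow_succ]; omega⟩
  simp [resistantBit, hlog]

theorem computable_resistantBit (U : TuringMachine) {t : ℕ → ℕ} (ht : Computable t) :
    Computable (resistantBit U t) := by
  have hi : Primrec fun x : ℕ => x.unpair.1 := Primrec.fst.comp Primrec.unpair
  have hy : Primrec fun x : ℕ => x.unpair.2 := Primrec.snd.comp Primrec.unpair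
  have hm : Primrec fun x : ℕ => Nat.log 2 x.unpair.2 := primrec_log_two.comp hy
  have hT : Computable fun x : ℕ =>
      t (Nat.pair x.unpair.1 (2 ^ (Nat.log 2 x.unpair.2 + 2))) :=
    ht.comp (Primrec₂.natPair.comp hi (primrec_two_pow.comp
      (Primrec.nat_add.comp hm (Primrec.const 2)))).to_comp
  exact (Primrec.list_getD false).to_comp.comp
    ((primrec_sparseString U).to_comp.comp (hi.to_comp.pair (hm.to_comp.pair hT)))
    (Primrec.nat_sub.comp hy (primrec_two_pow.comp hm)).to_comp

/-! ### Short descriptions of matching programs -/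

/-- The program length announced by the first `4m` bits of `u`. -/
def announcedLength (m : ℕ) (u : List Bool) : ℕ :=
  (strings (4 * m)).idxOf (u.take (4 * m))

/-- The output of the program that `u` describes, for `a = (i, m, T)`. The first `4m` bits of `u`
give the length `k` of the program; the remaining `k - 6m` bits give its index among the programs
of length `k` that match `sparseString U a`. -/
def decompress (U : TuringMachine) (a : ℕ × ℕ × ℕ) (u : List Bool) : List Bool :=
  let k := announcedLength a.2.1 u
  U.run ((matching U a k (sparseString U a)).getD
    ((strings (k - 6 * a.2.1)).idxOf (u.drop (4 * a.2.1))) []) a.2.2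

theorem primrec_idxOf_string : Primrec₂ (List.idxOf : List Bool → List (List Bool) → ℕ) :=
  Primrec.list_idxOf.of_eq fun _ _ => by
    congr 1
    exact lawful_beq_subsingleton _ _

theorem primrec_announcedLength : Primrec₂ announcedLength := by
  have h4 : Primrec fun x : ℕ × List Bool => 4 * x.1 :=
    Primrec.nat_mul.comp (Primrec.const 4) Primrec.fst
  exact primrec_idxOf_string.comp (Primrec.list_take.comp h4 Primrec.snd) (primrec_strings.comp h4)

theorem primrec_decompress (U : TuringMachine) : Primrec₂ (decompress U) := by
  have hm : Primrec fun x : (ℕ × ℕ × ℕ) × List Bool => x.1.2.1 :=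
    Primrec.fst.comp (Primrec.snd.comp Primrec.fst)
  have hk : Primrec fun x : (ℕ × ℕ × ℕ) × List Bool => announcedLength x.1.2.1 x.2 :=
    primrec_announcedLength.comp hm Primrec.snd
  have hidx : Primrec fun x : (ℕ × ℕ × ℕ) × List Bool =>
      (strings (announcedLength x.1.2.1 x.2 - 6 * x.1.2.1)).idxOf (x.2.drop (4 * x.1.2.1)) :=
    primrec_idxOf_string.comp
      (Primrec.list_drop.comp (Primrec.nat_mul.comp (Primrec.const 4) hm) Primrec.snd)
      (primrec_strings.comp (Primrec.nat_sub.comp hk (Primrec.nat_mul.comp (Primrec.const 6) hm)))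
  have hprogs : Primrec fun x : (ℕ × ℕ × ℕ) × List Bool =>
      matching U x.1 (announcedLength x.1.2.1 x.2) (sparseString U x.1) :=
    (primrec_matching U).comp ((Primrec.fst.pair hk).pair
      ((primrec_sparseString U).comp Primrec.fst))
  exact U.primrec_run.comp ((Primrec.list_getD []).comp hprogs hidx)
    (Primrec.snd.comp (Primrec.snd.comp Primrec.fst))

/-- The inputs of `decompress` of the right length. -/
def IsDescription (m : ℕ) (u : List Bool) : Bool :=
  decide (u.length = 4 * m + (announcedLength m u - 6 * m))

theorem primrec_isDescription : Primrec₂ IsDescription := by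
  have hm : ∀ c, Primrec fun x : ℕ × List Bool => c * x.1 := fun c =>
    Primrec.nat_mul.comp (Primrec.const c) Primrec.fst
  exact Primrec.eq.decide.comp (Primrec.list_length.comp Primrec.snd)
    (Primrec.nat_add.comp (hm 4) (Primrec.nat_sub.comp primrec_announcedLength (hm 6)))

theorem prefixFree_isDescription (m : ℕ) : PrefixFree {u | IsDescription m u = true} := by
  rintro u hu v hv h
  simp only [Set.mem_ofPred_eq, IsDescription, decide_eq_true_eq] at hu hv
  refine h.eq_of_length ?_
  have htake : u.take (4 * m) = v.take (4 * m) := by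
    obtain ⟨s, rfl⟩ := h
    rw [List.take_append_of_le_length (by omega)]
  rw [hu, hv, announcedLength, announcedLength, htake]

/-- A program `p` that matches a sparse string has a description `6m - 4m = 2m` bits shorter
than `p`. -/
theorem exists_description {U : TuringMachine} {a : ℕ × ℕ × ℕ} {p : List Bool}
    (ha : IsSparse U a (sparseString U a)) (hp : p.length < 2 ^ (4 * a.2.1))
    (hmatch : blockOf a.1 a.2.1 (U.run p a.2.2) = sparseString U a) :
    ∃ u, IsDescription a.2.1 u = true ∧ decompress U a u = U.run p a.2.2 ∧
      u.length + 2 * a.2.1 = p.length := by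
  set m := a.2.1 with hm
  have hmem : p ∈ matching U a p.length (sparseString U a) := by
    simp [matching, mem_strings, hmatch, ← hm]
  have hj := List.idxOf_lt_length_of_mem hmem
  set j := (matching U a p.length (sparseString U a)).idxOf p with hjdef
  have hcount := ha p.length hp
  rw [← hm] at hcount
  have h6 : 6 * m ≤ p.length := by
    rw [← Nat.pow_le_pow_iff_right (a := 2) (by norm_num)]
    refine le_trans ?_ hcount
    exact Nat.le_mul_of_pos_left _ (by omega)
  have hj' : j < (strings (p.length - 6 * m)).length := by
    rw [length_strings]
    refine lt_of_lt_of_le hj ?_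
    refine Nat.le_of_mul_le_mul_right (c := 2 ^ (6 * m)) ?_ (by positivity)
    rwa [← pow_add, Nat.sub_add_cancel h6]
  have hk : p.length < (strings (4 * m)).length := by rwa [length_strings]
  have hu1 : ((strings (4 * m))[p.length]).length = 4 * m := mem_strings.1 (List.getElem_mem _)
  have hu2 : ((strings (p.length - 6 * m))[j]).length = p.length - 6 * m :=
    mem_strings.1 (List.getElem_mem _)
  have hann : announcedLength m ((strings (4 * m))[p.length] ++ (strings (p.length - 6 * m))[j]) =
      p.length := by
    rw [announcedLength, List.take_left' hu1, (nodup_strings _).idxOf_getElem]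
  refine ⟨(strings (4 * m))[p.length] ++ (strings (p.length - 6 * m))[j], ?_, ?_, ?_⟩
  · simp [IsDescription, hann, hu1, hu2]
  · simp only [decompress, ← hm, hann, List.drop_left' hu1]
    rw [(nodup_strings _).idxOf_getElem, List.getD_eq_getElem _ _ hj, List.getElem_idxOf]
  · rw [List.length_append, hu1, hu2]
    omega

/-! ### Agreement implies strong depth -/

theorem length_initSeg (X : ℕ → Bool) (n : ℕ) : (initSeg X n).length = n := by
  simp [initSeg]

theorem getD_initSeg (X : ℕ → Bool) {n x : ℕ} (h : x < n) : (initSeg X n).getD x false = X x := by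
  simp [initSeg, List.getD, h]

theorem exists_pair_two_pow_le_lt (i m₀ : ℕ) {n : ℕ} (hn : Nat.pair i (2 ^ (m₀ + 1)) ≤ n) :
    ∃ m ≥ m₀, Nat.pair i (2 ^ (m + 1)) ≤ n ∧ n < Nat.pair i (2 ^ (m + 2)) := by
  have hex : ∃ d, n < Nat.pair i (2 ^ (m₀ + d + 2)) := by
    refine ⟨n, lt_of_lt_of_le (Nat.lt_two_pow_self) ((Nat.pow_le_pow_right (by norm_num) ?_).trans
      (Nat.right_le_pair _ _))⟩
    omega
  classical
  refine ⟨m₀ + Nat.find hex, by omega, ?_, Nat.find_spec hex⟩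
  rcases h : Nat.find hex with _ | d
  · exact hn
  · exact not_lt.1 (Nat.find_min hex (m := d) (by omega))

/-- A sequence that agrees, at almost all positions `x = ⟨i, y⟩` with `φ_i(x)↓`, with the bit
`φ_i(x) = 1`, is strongly deep. For a computable `t`, some `φ_i` computes the resistant bits for
`t`. So the column `i` of `X` is almost everywhere resistant, and a program that outputs `X ↾ n`
within time `t(n)` can be shortened, as it matches a sparse string on a block of this column. -/
theorem isStronglyDeep_of_eventually_agrees {U : TuringMachine} (hU : U.IsUniversalPrefixFree)
    {X : ℕ → Bool} {x₀ : ℕ}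
    (hX : ∀ x ≥ x₀, ∀ v ∈ (Denumerable.ofNat Code x.unpair.1).eval x, X x = decide (v = 1)) :
    IsStronglyDeep U X := by
  intro t ht htm c
  obtain ⟨code, hcode⟩ := Code.exists_code.1
    (Partrec.nat_iff.1 (Computable.encode.comp (computable_resistantBit U ht)).partrec)
  set i := Encodable.encode code with hi
  have hcol : ∀ y, x₀ ≤ y → X (Nat.pair i y) = resistantBit U t (Nat.pair i y) := by
    intro y hy
    have := hX (Nat.pair i y) (hy.trans (Nat.right_le_pair _ _))
      (Encodable.encode (resistantBit U t (Nat.pair i y)))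
      (by simp [hi, Denumerable.ofNat_encode, hcode])
    rw [this]
    cases resistantBit U t (Nat.pair i y) <;> rfl
  let a : ℕ → ℕ × ℕ × ℕ := fun m => (i, m, t (Nat.pair i (2 ^ (m + 2))))
  have hacomp : Computable a :=
    (Computable.const i).pair (Computable.id.pair (ht.comp
      (Primrec₂.natPair.comp (Primrec.const i) (primrec_two_pow.comp
        (Primrec.nat_add.comp Primrec.id (Primrec.const 2)))).to_comp))
  have hfcomp : Computable₂ fun m u => decompress U (a m) u :=
    (primrec_decompress U).to_comp.comp (hacomp.comp Computable.fst) Computable.snd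
  obtain ⟨C₁, hC₁⟩ := exists_complexity_le hU hfcomp primrec_isDescription.to_comp
    prefixFree_isDescription
  obtain ⟨C₂, hC₂⟩ := exists_complexity_le_two_mul_length hU
  rw [Filter.eventually_atTop]
  -- for `m ≥ 6` there are sparse strings, for `m ≥ x₀` block `m` lies beyond `x₀`, for `m ≥ C₁ + c`
  -- the savings suffice, and for `m ≥ i + C₂ + c` all `k ≥ 2^{4m}` exceed `2n + C₂ + c`
  refine ⟨Nat.pair i (2 ^ (6 + i + x₀ + C₁ + C₂ + c + 1)), fun n hn => ?_⟩
  obtain ⟨m, hm, hmn, hnm⟩ := exists_pair_two_pow_le_lt i _ hn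
  have hmpow : m < 2 ^ m := Nat.lt_two_pow_self
  have h10 : 10 * m ≤ 2 ^ m := by
    have : ∀ d, 10 * (6 + d) ≤ 2 ^ (6 + d) := by
      intro d
      induction d with
      | zero => norm_num
      | succ d ih => rw [← add_assoc, pow_succ]; omega
    have := this (m - 6)
    rwa [Nat.add_sub_cancel' (by omega)] at this
  have hspec := sparseString_spec U (a m) h10
  refine le_iInf₂ fun p hp => ?_
  have hrun : U.run p (a m).2.2 = initSeg X n := by
    obtain ⟨s, hs, hps⟩ := hp
    refine U.run_eq_of_outputsWithin ⟨s, hs.trans (htm ?_), hps⟩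
    rw [length_initSeg]
    exact hnm.le
  by_cases hpm : p.length < 2 ^ (4 * m)
  · have hblock : blockOf i m (initSeg X n) = sparseString U (a m) := by
      refine List.ext_getElem (by simp [blockOf, hspec.1, a]) fun r hr hr' => ?_
      have hr2 : r < 2 ^ m := by simpa [blockOf] using hr
      have hlt : Nat.pair i (2 ^ m + r) < n :=
        lt_of_lt_of_le (Nat.pair_lt_pair_right i (by rw [pow_succ]; omega)) hmn
      simp only [blockOf, List.getElem_map, List.getElem_range]
      rw [getD_initSeg X hlt, hcol _ (by omega), resistantBit_pair U t hr2,
        List.getD_eq_getElem _ _ hr']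
    obtain ⟨u, hu, hdec, hlen⟩ := exists_description (a := a m) hspec.2 hpm
      (by rw [hrun]; exact hblock)
    have hle := hC₁ m u hu
    rw [hdec, hrun] at hle
    refine (add_le_add_left hle _).trans ?_
    have hlen' : u.length + 2 * m = p.length := hlen
    exact_mod_cast (by omega)
  · have hle := hC₂ (initSeg X n)
    rw [length_initSeg] at hle
    refine (add_le_add_left hle _).trans ?_
    have hn2 : n < 2 ^ (2 * m + 6) := by
      refine hnm.trans_le ((Nat.pair_lt_max_add_one_sq _ _).le.trans ?_)
      have : 2 * m + 6 = (m + 3) * 2 := by ring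
      rw [this, pow_mul]
      refine Nat.pow_le_pow_left ?_ 2
      have h2 : 2 ^ (m + 2) = 4 * 2 ^ m := by ring
      have h3 : 2 ^ (m + 3) = 8 * 2 ^ m := by ring
      omega
    have h4 : 2 ^ (2 * m + 8) ≤ 2 ^ (4 * m) := Nat.pow_le_pow_right (by norm_num) (by omega)
    have h5 : 2 ^ (2 * m + 8) = 4 * 2 ^ (2 * m + 6) := by ring
    have h6 : 2 ^ m ≤ 2 ^ (2 * m + 6) := Nat.pow_le_pow_right (by norm_num) (by omega)
    exact_mod_cast (by omega)

/-! ### The class -/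

/-- The value at `x` of the partial function with index `i`, where `x = ⟨i, y⟩`, as far as it is
known at stage `s`. -/
def stageValue (s x : ℕ) : Option ℕ :=
  (Denumerable.ofNat Code x.unpair.1).evaln s x

/-- The string of length `r` that agrees with all values known at stage `r`. -/
def stageString (r : ℕ) : List Bool :=
  (List.range r).map fun x => decide (stageValue r x = some 1)

/-- At stage `|σ|`, the string `σ` is seen to disagree with a known value at a position `x`, and no
`stageString r` with `r > x`, as an initial segment of `σ`, excuses this. -/
def Offends (σ : List Bool) : Prop :=
  ∃ x < σ.length, (stageValue σ.length x ≠ none ∧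
    σ.getD x false ≠ decide (stageValue σ.length x = some 1)) ∧
      ∀ r < σ.length + 1, x < r → stageString r ≠ σ.take r

/-- The sequences without offending initial segment. -/
def agreementClass : Set (ℕ → Bool) := {X | ∀ n, ¬ Offends (initSeg X n)}

theorem lt_of_stageValue {s x v : ℕ} (h : stageValue s x = some v) : x < s :=
  Code.evaln_bound h

theorem stageValue_mono {s s' x v : ℕ} (hs : s ≤ s') (h : stageValue s x = some v) :
    stageValue s' x = some v :=
  Code.evaln_mono hs h

theorem length_stageString (r : ℕ) : (stageString r).length = r := by
  simp [stageString]

theorem getD_stageString {r x : ℕ} (hx : x < r) :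
    (stageString r).getD x false = decide (stageValue r x = some 1) := by
  simp [stageString, List.getD, hx]

theorem take_initSeg (X : ℕ → Bool) {r n : ℕ} (h : r ≤ n) :
    (initSeg X n).take r = initSeg X r := by
  simp [initSeg, ← List.map_take, List.take_range, h]

theorem mem_agreementClass {X : ℕ → Bool} :
    X ∈ agreementClass ↔ ∀ n x v, stageValue n x = some v → X x ≠ decide (v = 1) →
      ∃ r ≤ n, x < r ∧ stageString r = initSeg X r := by
  simp only [agreementClass, Offends, Set.mem_ofPred_eq, length_initSeg]
  constructor
  · intro h n x v hv hX
    by_contra! hno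
    have hx := lt_of_stageValue hv
    refine h n ⟨x, hx, ⟨by simp [hv], ?_⟩, fun r hr hxr => ?_⟩
    · rw [getD_initSeg X hx, hv]
      simpa using hX
    · rw [take_initSeg X (by omega)]
      exact hno r (by omega) hxr
  · rintro h n ⟨x, hx, ⟨hne, hX⟩, hno⟩
    obtain ⟨v, hv⟩ := Option.ne_none_iff_exists'.1 hne
    rw [getD_initSeg X hx, hv] at hX
    obtain ⟨r, hr, hxr, hr'⟩ := h n x v hv (by simpa using hX)
    exact hno r (by omega) hxr (by rw [take_initSeg X hr, hr'])

/-- A member of the class disagrees with only finitely many values: once a disagreement at `x` is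
known, say at stage `s`, the strings `stageString r` with `r ≥ s` avoid it, so that the
excuse for any other disagreement comes from some `r < s`. -/
theorem eventually_agrees_of_mem {X : ℕ → Bool} (hX : X ∈ agreementClass) :
    ∃ x₀, ∀ x ≥ x₀, ∀ v ∈ (Denumerable.ofNat Code x.unpair.1).eval x, X x = decide (v = 1) := by
  rw [mem_agreementClass] at hX
  by_contra! hno
  obtain ⟨x, -, v, hv, hXx⟩ := hno 0
  obtain ⟨s, hs⟩ := Code.evaln_complete.1 hv
  have hs : stageValue s x = some v := hs
  obtain ⟨x', hx', v', hv', hXx'⟩ := hno s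
  obtain ⟨s', hs'⟩ := Code.evaln_complete.1 hv'
  obtain ⟨r, -, hxr, hr⟩ := hX s' x' v' hs' hXx'
  have hsr : s ≤ r := by omega
  have hval := stageValue_mono hsr hs
  have hx := lt_of_stageValue hval
  apply hXx
  rw [← getD_initSeg X hx, ← hr, getD_stageString hx, hval]
  simp

/-- Each `stageString r` extends to a member of the class, which agrees with all values beyond
position `r`. -/
theorem stageString_mem_treeLevel (r : ℕ) : stageString r ∈ treeLevel agreementClass r := by
  classical
  let X : ℕ → Bool := fun x =>
    if x < r then (stageString r).getD x false
    else decide (1 ∈ (Denumerable.ofNat Code x.unpair.1).eval x)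
  have hseg : stageString r = initSeg X r := by
    refine List.ext_getElem (by simp [length_stageString, length_initSeg]) fun x hx hx' => ?_
    rw [length_stageString] at hx
    rw [← List.getD_eq_getElem _ false, ← List.getD_eq_getElem _ false, getD_initSeg X hx]
    simp [X, hx]
  refine ⟨X, mem_agreementClass.2 fun n x v hv hXx => ?_, hseg⟩
  have hxr : x < r := by
    by_contra hxr
    apply hXx
    have hval : v ∈ (Denumerable.ofNat Code x.unpair.1).eval x := Code.evaln_sound hv
    have hiff : 1 ∈ (Denumerable.ofNat Code x.unpair.1).eval x ↔ v = 1 :=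
      ⟨fun h => Part.mem_unique hval h, fun h => h ▸ hval⟩
    simp only [X, hxr, if_false, hiff]
  refine ⟨r, ?_, hxr, hseg⟩
  by_contra! hnr
  apply hXx
  rw [← getD_initSeg X hxr, ← hseg, getD_stageString hxr, stageValue_mono hnr.le hv]
  simp

theorem primrec_stageValue : Primrec₂ stageValue :=
  Code.primrec_evaln.comp ((Primrec.fst.pair ((Primrec.ofNat Code).comp
    (Primrec.fst.comp (Primrec.unpair.comp Primrec.snd)))).pair Primrec.snd)

theorem primrec_stageString : Primrec stageString :=
  Primrec.list_map Primrec.list_range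
    (Primrec.eq.decide.comp₂ primrec_stageValue (Primrec₂.const (some 1)))

theorem primrecPred_offends : PrimrecPred Offends := by
  have hlen : Primrec fun z : ℕ × List Bool => z.2.length :=
    Primrec.list_length.comp Primrec.snd
  have hval : Primrec fun z : ℕ × List Bool => stageValue z.2.length z.1 :=
    primrec_stageValue.comp hlen Primrec.fst
  have h1 : PrimrecPred fun z : ℕ × List Bool => stageValue z.2.length z.1 ≠ none :=
    (Primrec.eq.comp hval (Primrec.const none)).not
  have h2 : PrimrecPred fun z : ℕ × List Bool =>
      z.2.getD z.1 false ≠ decide (stageValue z.2.length z.1 = some 1) :=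
    (Primrec.eq.comp ((Primrec.list_getD false).comp Primrec.snd Primrec.fst)
      (Primrec.eq.decide.comp hval (Primrec.const (some 1)))).not
  have h3 : PrimrecRel fun (r : ℕ) (z : ℕ × List Bool) =>
      ¬ z.1 < r ∨ ¬ stageString r = z.2.take r :=
    ((Primrec.nat_lt.comp (Primrec.fst.comp Primrec.snd) Primrec.fst).not).or
      (Primrec.eq.comp (primrec_stageString.comp Primrec.fst)
        (Primrec.list_take.comp Primrec.fst (Primrec.snd.comp Primrec.snd))).not
  have h4 : PrimrecPred fun z : ℕ × List Bool =>
      ∀ r < z.2.length + 1, ¬ z.1 < r ∨ ¬ stageString r = z.2.take r :=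
    primrecPred_forall_lt h3 (Primrec.succ.comp hlen)
  have h5 : PrimrecRel fun (x : ℕ) (σ : List Bool) => ¬ ((stageValue σ.length x ≠ none ∧
      σ.getD x false ≠ decide (stageValue σ.length x = some 1)) ∧
        ∀ r < σ.length + 1, ¬ x < r ∨ ¬ stageString r = σ.take r) :=
    ((h1.and h2).and h4).not
  refine (primrecPred_forall_lt h5 Primrec.list_length).not.of_eq fun σ => ?_
  simp only [Offends, ← imp_iff_not_or]
  push Not
  rfl

theorem isPi01Class_agreementClass : IsPi01Class agreementClass :=
  ⟨Offends, primrecPred_offends.computablePred.to_re, rfl⟩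

/-! ### Failure of depth -/

/-- The semimeasure with a point mass `2^{-d-1}` at each string `τ d`. -/
noncomputable def pointMasses (τ : ℕ → List Bool) (σ : List Bool) : ℝ :=
  ∑' d, if σ <+: τ d then (1 : ℝ) / 2 / 2 ^ d else 0

theorem summable_pointMasses (τ : ℕ → List Bool) (σ : List Bool) :
    Summable fun d => if σ <+: τ d then (1 : ℝ) / 2 / 2 ^ d else 0 := by
  refine Summable.of_nonneg_of_le (fun d => ?_) (fun d => ?_) (hasSum_geometric_two' 1).summable
  · split_ifs <;> positivity
  · split_ifs
    · exact le_rfl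
    · positivity

theorem isContSemimeasure_pointMasses (τ : ℕ → List Bool) :
    IsContSemimeasure (pointMasses τ) where
  nonneg σ := tsum_nonneg fun d => by split_ifs <;> positivity
  root := by
    refine le_of_eq ?_
    simp only [pointMasses, List.nil_prefix, if_true]
    exact (hasSum_geometric_two' 1).tsum_eq
  split σ := by
    rw [pointMasses, pointMasses, pointMasses,
      ← (summable_pointMasses τ _).tsum_add (summable_pointMasses τ _)]
    refine ((summable_pointMasses τ _).add (summable_pointMasses τ _)).tsum_le_tsum
      (fun d => ?_) (summable_pointMasses τ _)
    have hpos : (0 : ℝ) ≤ 1 / 2 / 2 ^ d := by positivity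
    by_cases h0 : σ ++ [false] <+: τ d
    · have h1 : ¬ σ ++ [true] <+: τ d := fun h1 => by
        have := List.prefix_of_prefix_length_le h0 h1 (by simp)
        simpa using this.eq_of_length (by simp)
      rw [if_pos h0, if_neg h1, if_pos ((List.prefix_append _ _).trans h0), add_zero]
    · rw [if_neg h0, zero_add]
      by_cases h1 : σ ++ [true] <+: τ d
      · rw [if_pos h1, if_pos ((List.prefix_append _ _).trans h1)]
      · rw [if_neg h1]
        split_ifs <;> positivity

/-- The number with binary digits `[σ <+: τ 0], …, [σ <+: τ (s - 1)]`: the numerator, over `2^s`, of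
the `s`-th partial sum of `pointMasses τ σ`. -/
def prefixCode (τ : ℕ → List Bool) (σ : List Bool) : ℕ → ℕ
  | 0 => 0
  | s + 1 => 2 * prefixCode τ σ s + bif decide ((τ s).take σ.length = σ) then 1 else 0

theorem isLowerSemicomputable_pointMasses {τ : ℕ → List Bool} (hτ : Computable τ) :
    IsLowerSemicomputable (pointMasses τ) := by
  have ha : Computable₂ (prefixCode τ) := by
    have hσ : Computable fun z : (List Bool × ℕ) × (ℕ × ℕ) => z.1.1 :=
      Computable.fst.comp Computable.fst
    have htest : Computable fun z : (List Bool × ℕ) × (ℕ × ℕ) =>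
        decide ((τ z.2.1).take z.1.1.length = z.1.1) :=
      Primrec.eq.decide.to_comp.comp (Primrec.list_take.to_comp.comp
        (Computable.list_length.comp hσ) (hτ.comp (Computable.fst.comp Computable.snd))) hσ
    have hstep : Computable₂ fun (x : List Bool × ℕ) (z : ℕ × ℕ) =>
        2 * z.2 + bif decide ((τ z.1).take x.1.length = x.1) then 1 else 0 :=
      Primrec.nat_add.to_comp.comp
        (Primrec.nat_double.to_comp.comp (Computable.snd.comp Computable.snd))
        (Computable.cond htest (Computable.const 1) (Computable.const 0))
    refine (Computable.nat_rec Computable.snd (Computable.const 0) hstep).of_eq fun x => ?_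
    induction x.2 with
    | zero => rfl
    | succ s ih => simp only [prefixCode, ← ih]
  have hb : Computable₂ fun (_ : List Bool) (s : ℕ) => 2 ^ s - 1 :=
    (Primrec.nat_sub.comp (primrec_two_pow.comp Primrec.snd) (Primrec.const 1)).to_comp
  refine ⟨prefixCode τ, _, ha, hb, fun σ => ?_⟩
  have hsum : ∀ s, (prefixCode τ σ s : ℝ) / (((2 ^ s - 1 : ℕ) : ℝ) + 1) =
      ∑ d ∈ Finset.range s, if σ <+: τ d then (1 : ℝ) / 2 / 2 ^ d else 0 := by
    intro s
    have hcast : (((2 ^ s - 1 : ℕ) : ℝ) + 1) = 2 ^ s := by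
      rw [Nat.cast_sub Nat.one_le_two_pow]
      push_cast
      ring
    rw [hcast]
    clear hcast
    induction s with
    | zero => simp [prefixCode]
    | succ s ih =>
      have hstep : prefixCode τ σ (s + 1) = 2 * prefixCode τ σ s + if σ <+: τ s then 1 else 0 := by
        simp only [prefixCode, List.prefix_iff_eq_take, eq_comm (a := σ), Bool.cond_decide]
      rw [Finset.sum_range_succ, ← ih, hstep]
      split_ifs <;> push_cast <;> field_simp <;> ring
  simp only [hsum]
  exact ⟨monotone_nat_of_le_succ fun s => by
      rw [Finset.sum_range_succ]
      refine le_add_of_nonneg_right ?_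
      split_ifs <;> positivity,
    (summable_pointMasses τ σ).hasSum.tendsto_sum_nat⟩

/-- A universal semimeasure gives the members of a computable sequence of strings at least the
weights `2^{-d}`, up to a constant factor. -/
theorem exists_two_pow_le_mul {M : List Bool → ℝ} (hM : IsUniversalContSemimeasure M)
    {τ : ℕ → List Bool} (hτ : Computable τ) :
    ∃ c : ℝ, ∀ d, (1 : ℝ) / 2 / 2 ^ d ≤ c * M (τ d) := by
  obtain ⟨c, hc⟩ := hM.universal _ (isContSemimeasure_pointMasses τ)
    (isLowerSemicomputable_pointMasses hτ)
  refine ⟨c, fun d => le_trans ?_ (hc (τ d))⟩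
  have := (summable_pointMasses τ (τ d)).le_tsum d fun e _ => by split_ifs <;> positivity
  simpa [pointMasses] using this

theorem le_finsum_treeLevel {M : List Bool → ℝ} (hM : IsContSemimeasure M)
    {P : Set (ℕ → Bool)} {n : ℕ} {σ : List Bool} (hσ : σ ∈ treeLevel P n) :
    M σ ≤ ∑ᶠ ρ ∈ treeLevel P n, M ρ := by
  have hfin : (treeLevel P n).Finite := by
    refine (strings n).toFinset.finite_toSet.subset ?_
    rintro _ ⟨X, -, rfl⟩
    simp [mem_strings, length_initSeg]
  rw [finsum_mem_eq_finite_toFinset_sum _ hfin]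
  exact Finset.single_le_sum (fun ρ _ => hM.nonneg ρ) (hfin.mem_toFinset.2 hσ)

/-- A class whose tree contains a string `τ r` of each length `r`, with `τ` computable, is not deep:
for an order `g`, the first lengths `r_d` with `g(r_d) ≥ 2d` form a computable sequence, so
that `τ (r_d)` has weight at least `2^{-d}`, up to a constant factor, and not `2^{-2d}`. -/
theorem not_isDeep_of_computable {M : List Bool → ℝ} (hM : IsUniversalContSemimeasure M)
    {P : Set (ℕ → Bool)} {τ : ℕ → List Bool} (hτ : Computable τ)
    (hP : ∀ r, τ r ∈ treeLevel P r) : ¬ IsDeep M P := by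
  rintro ⟨g, ⟨hg, -, hunb⟩, hdeep⟩
  have hcomp : Computable fun d => Nat.find (hunb (2 * d)) := by
    have hle : ComputablePred fun z : ℕ × ℕ => 2 * z.1 ≤ g z.2 :=
      (Primrec.nat_le.decide.to_comp.comp
        (Primrec.nat_double.to_comp.comp Computable.fst) (hg.comp Computable.snd)).computablePred
    exact Computable.find (P := fun d r => 2 * d ≤ g r) hle fun d => hunb (2 * d)
  obtain ⟨c, hc⟩ := exists_two_pow_le_mul hM (hτ.comp hcomp)
  have hbound : ∀ d : ℕ, (2 : ℝ) ^ d ≤ 2 * |c| := by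
    intro d
    set r := Nat.find (hunb (2 * d)) with hr
    have hgr : 2 * d ≤ g r := Nat.find_spec (hunb (2 * d))
    have hMr : M (τ r) ≤ (2 : ℝ)⁻¹ ^ (2 * d) :=
      (le_finsum_treeLevel hM.semimeasure (hP r)).trans ((hdeep r).trans
        (pow_le_pow_of_le_one (by norm_num) (by norm_num) hgr))
    have hcr : (1 : ℝ) / 2 / 2 ^ d ≤ |c| * (2 : ℝ)⁻¹ ^ (2 * d) :=
      (hc d).trans ((mul_le_mul_of_nonneg_right (le_abs_self c)
        (hM.semimeasure.nonneg _)).trans (mul_le_mul_of_nonneg_left hMr (abs_nonneg c)))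
    rw [pow_mul', inv_pow, div_div, div_le_iff₀ (by positivity)] at hcr
    have : |c| * ((2 : ℝ) ^ d)⁻¹ ^ 2 * (2 * 2 ^ d) = 2 * |c| / 2 ^ d := by
      field_simp
    rw [this, le_div_iff₀ (by positivity)] at hcr
    linarith
  obtain ⟨d, hd⟩ := pow_unbounded_of_one_lt (2 * |c|) (one_lt_two : (1 : ℝ) < 2)
  exact absurd (hbound d) (not_le.2 hd)

end DeepClass

theorem mainTheorem11
    (U : DeepClass.TuringMachine) (hU : U.IsUniversalPrefixFree)
    (M : List Bool → ℝ) (hM : DeepClass.IsUniversalContSemimeasure M) :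
    ∃ P : Set (ℕ → Bool), DeepClass.IsPi01Class P ∧
      (∀ X ∈ P, DeepClass.IsStronglyDeep U X) ∧ ¬ DeepClass.IsDeep M P := by
  refine ⟨DeepClass.agreementClass, DeepClass.isPi01Class_agreementClass, fun X hX => ?_,
    DeepClass.not_isDeep_of_computable hM DeepClass.primrec_stageString.to_comp
      DeepClass.stageString_mem_treeLevel⟩
  obtain ⟨x₀, hx₀⟩ := DeepClass.eventually_agrees_of_mem hX
  exact DeepClass.isStronglyDeep_of_eventually_agrees hU hx₀
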